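/- **Setting.** An instance of the strategic knapsack problem consists of a number $n\ge 1$ of agents, a finite set $E$ of items, each item $i\in E$ having an owner $a(i)\in[n]$, a value $v_i>0$ and a size $s_i>0$, and a capacity $C>0$. For $D\subseteq E$ write $v(D)=\sum_{i\in D}v_i$, $s(D)=\sum_{i\in D}s_i$, $D_a=\{i\in D: a(i)=a\}$ and $v_a(D)=v(D_a)$. It is assumed throughout that $s_i\le C$ for every item; that distinct items have distinct values and distinct sizes; and that for all $E'\subseteq E$ and $0\le C'\le C$ the problem $\max\{v(D): D\subseteq E',\ s(D)\le C'\}$ has a unique optimal solution. For $D\subseteq E$ let $\mathrm{Opt}(D)$ be the optimal solution for the items $D$ and capacity $C$. An instance has *unit density* if $v_i=s_i$ for all $i\in E$. A deterministic mechanism $M$ maps each instance, as a function only of the agents, the capacity and the items in the instance with their owners, values and sizes, to a set $M(E)\subseteq E$ with $s(M(E))\le C$. It is *strategyproof* on unit-density instances if for every such instance with items $E$, every agent $a$ and every $E'\subseteq E$ with $E\setminus E'\subseteq E_a$ one has $v_a(M(E))\ge v_a(M(E'))$, where $M(E')$ is the output on the instance in which only the items $E'$ are reported. It is *$\alpha$-approximate*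 on unit-density instances if $v(M(E))\ge\alpha\, v(\mathrm{Opt}(E))$ for every such instance. **The mechanism FitTwo with parameter $\beta$.** If $\max_{a} v(\mathrm{Opt}(E_a))\ge\beta C$, return $\mathrm{Opt}(E_{a'})$, where $a'=\arg\max_{a} v(\mathrm{Opt}(E_a))$. Otherwise let $P$ be the set of items $i\in E$ such that $v_i+v_j\le C$ for every $j\in E\setminus E_{a(i)}$ with $v_j<v_i$, let $i^*$ be the most valuable item of $P$, and let $R=\{i^*\}\cup\{i\in E: v_{i^*}+v_i\le C\}$ (with $R=\emptyset$ if $E=\emptyset$). Let $x(R)\in[0,1]^R$ be the fractional greedy solution: the items of $R$ are taken in order of decreasing density (ties broken in favour of larger value) and packed completely as long as they fit, the next item is packed fractionally so as to fill the capacity, and all later items are left out. Return $\bigcup_{a\in[n]}E^*_a$, where $E^*_a$ is the most valuable set $D\subseteq E_a$ with $v(D)\le\sum_{i\in R_a}v_i x_i(R)$. **Theorem.** For every $\beta\in[1/2,2/3]$, FitTwo with parameter $\beta$ is, on unit-density instances, a deterministic mechanism that is strategyproof and $\min\{\beta,\frac{1-\beta}{\beta}\}$-approximate. In particular, there is a strategyproof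 and $\frac1\phi$-approximate deterministic mechanism on unit-density instances, where $\phi=\frac{1+\sqrt5}{2}$ is the golden ratio, namely FitTwo with parameter $\beta=1/\phi$. -/

import Mathlib

/-- The total weight `w(D) = ∑_{i ∈ D} w i` of a finite set of items. -/
def total {ι : Type*} (w : ι → ℝ) (D : Finset ι) : ℝ := ∑ i ∈ D, w i

/-- `D` is an optimal solution of the knapsack problem with items `E`, values `v`, sizes `s`
and capacity `c`. -/
def IsOptimalPacking {ι : Type*} (v s : ι → ℝ) (E : Finset ι) (c : ℝ) (D : Finset ι) : Prop :=
  (D ⊆ E ∧ total s D ≤ c) ∧ ∀ D', D' ⊆ E → total s D' ≤ c → total v D' ≤ total v D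

/-- An instance of the strategic knapsack problem: `n ≥ 1` agents, a finite set `items` of items
taken from a type `ι` of labels, an owner, a positive value and a positive size for each item,
and a positive capacity. The last four fields are the standing non-degeneracy assumptions: every
item fits on its own, values and sizes are pairwise distinct, and every reduced knapsack problem
has a unique optimal solution. The functions `owner`, `value`, `size` only matter on `items`. -/
structure KnapsackInstance (ι : Type*) where
  n : ℕ
  items : Finset ι
  owner : ι → Fin n
  value : ι → ℝ
  size : ι → ℝ
  capacity : ℝ
  n_pos : 0 < n
  value_pos : ∀ i ∈ items, 0 < value i
  size_pos : ∀ i ∈ items, 0 < size i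
  capacity_pos : 0 < capacity
  size_le : ∀ i ∈ items, size i ≤ capacity
  value_inj : ∀ i ∈ items, ∀ j ∈ items, i ≠ j → value i ≠ value j
  size_inj : ∀ i ∈ items, ∀ j ∈ items, i ≠ j → size i ≠ size j
  opt_unique : ∀ E', E' ⊆ items → ∀ c : ℝ, 0 ≤ c → c ≤ capacity →
    ∃! D, IsOptimalPacking value size E' c D

/-- `a` is a maximizer of `f` on the finite set `S` (an arbitrary one if there are several). -/
noncomputable def argmax {α : Type*} [Nonempty α] (S : Finset α) (f : α → ℝ) : α :=
  Classical.epsilon fun a => a ∈ S ∧ ∀ b ∈ S, f b ≤ f a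

theorem argmax_spec {α : Type*} [Nonempty α] (S : Finset α) (f : α → ℝ) (hS : S.Nonempty) :
    argmax S f ∈ S ∧ ∀ b ∈ S, f b ≤ f (argmax S f) := by
  obtain ⟨a, ha, h⟩ := S.exists_max_image f hS
  exact Classical.epsilon_spec (p := fun a => a ∈ S ∧ ∀ b ∈ S, f b ≤ f a) ⟨a, ha, h⟩

namespace KnapsackInstance

variable {ι : Type*}

instance instNonemptyAgents (I : KnapsackInstance ι) : Nonempty (Fin I.n) := ⟨⟨0, I.n_pos⟩⟩

/-- The instance in which only the items in `E'` are reported; everything else is unchanged. -/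
def restrict (I : KnapsackInstance ι) (E' : Finset ι) (h : E' ⊆ I.items) :
    KnapsackInstance ι where
  n := I.n
  items := E'
  owner := I.owner
  value := I.value
  size := I.size
  capacity := I.capacity
  n_pos := I.n_pos
  value_pos i hi := I.value_pos i (h hi)
  size_pos i hi := I.size_pos i (h hi)
  capacity_pos := I.capacity_pos
  size_le i hi := I.size_le i (h hi)
  value_inj i hi j hj := I.value_inj i (h hi) j (h hj)
  size_inj i hi j hj := I.size_inj i (h hi) j (h hj)
  opt_unique E'' h'' := I.opt_unique E'' (h''.trans h)

/-- The two instances are the same instance: they agree in the number of agents, the capacity,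
the set of items, and the owner, value and size of every item in that set. -/
def SameData (I J : KnapsackInstance ι) : Prop :=
  I.n = J.n ∧ I.items = J.items ∧ I.capacity = J.capacity ∧
    ∀ i ∈ I.items, (I.owner i : ℕ) = (J.owner i : ℕ) ∧ I.value i = J.value i ∧ I.size i = J.size i

/-- The items of agent `a` in `D`, for a set of items `D ⊆ E`. -/
def ofAgent (I : KnapsackInstance ι) (a : Fin I.n) (D : Finset ι) : Finset ι :=
  D.filter fun i => I.owner i = a

/-- `v_a(D)`, the total value of the items of agent `a` in `D`. -/
def agentValue (I : KnapsackInstance ι) (a : Fin I.n) (D : Finset ι) : ℝ :=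
  total I.value (I.ofAgent a D)

/-- The density of an item. -/
noncomputable def density (I : KnapsackInstance ι) (i : ι) : ℝ := I.value i / I.size i

/-- The set of unit-density instances. -/
def unitDensity (ι : Type*) : Set (KnapsackInstance ι) :=
  {I | ∀ i ∈ I.items, I.density i = 1}

/-- `Opt(D)`: the optimal solution for the items `D ⊆ E` and the full capacity. -/
noncomputable def opt (I : KnapsackInstance ι) (D : Finset ι) : Finset ι :=
  argmax (D.powerset.filter fun D' => total I.size D' ≤ I.capacity) (total I.value)

/-- The items of `Q` that precede `i` in the greedy order: higher density first, ties broken in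
favour of higher value. -/
noncomputable def greedyBefore (I : KnapsackInstance ι) (Q : Finset ι) (i : ι) : Finset ι :=
  Q.filter fun j => I.density i < I.density j ∨
    (I.density j = I.density i ∧ I.value i < I.value j)

/-- The fractional greedy solution `x(Q)`: items are packed in greedy order as long as they fit
completely, the next item is packed fractionally, and all later ones are left out. -/
noncomputable def greedyFrac (I : KnapsackInstance ι) (Q : Finset ι) (i : ι) : ℝ :=
  if total I.size (I.greedyBefore Q i) + I.size i ≤ I.capacity then 1
  else if total I.size (I.greedyBefore Q i) ≤ I.capacity then
    (I.capacity - total I.size (I.greedyBefore Q i)) / I.size i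
  else 0

/-- The quota `∑_{i ∈ Q_a} v_i x_i(Q)` of agent `a`. -/
noncomputable def quota (I : KnapsackInstance ι) (Q : Finset ι) (a : Fin I.n) : ℝ :=
  ∑ i ∈ I.ofAgent a Q, I.value i * I.greedyFrac Q i

/-- The mechanism RestrictedGreedy: each agent packs the most valuable subset of all own items
whose value does not exceed the agent's quota for the set `Q`. -/
noncomputable def restrictedGreedy [DecidableEq ι] (I : KnapsackInstance ι) (Q : Finset ι) :
    Finset ι :=
  Finset.univ.biUnion fun a : Fin I.n =>
    argmax ((I.ofAgent a I.items).powerset.filter fun D => total I.value D ≤ I.quota Q a)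
      (total I.value)

/-- The set `P` of items that fit together with every less valuable item of another agent. -/
noncomputable def fitSet (I : KnapsackInstance ι) : Finset ι :=
  I.items.filter fun i => ∀ j ∈ I.items, I.owner j ≠ I.owner i → I.value j < I.value i →
    I.value i + I.value j ≤ I.capacity

/-- `i` is the most valuable item `i*` of `P`. (Values are distinct, so there is at most one such
item, and exactly one unless there are no items at all.) -/
def IsStar (I : KnapsackInstance ι) (i : ι) : Prop :=
  i ∈ I.fitSet ∧ ∀ j ∈ I.fitSet, I.value j ≤ I.value i

open Classical in
/-- The set `R = {i*} ∪ {i ∈ E | v_{i*} + v_i ≤ C}` (empty if there are no items). -/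
noncomputable def restrictedSet (I : KnapsackInstance ι) : Finset ι :=
  I.items.filter fun i => I.IsStar i ∨ ∃ k, I.IsStar k ∧ I.value k + I.value i ≤ I.capacity

open Classical in
/-- The mechanism FitTwo with parameter `β`. -/
noncomputable def fitTwo [DecidableEq ι] (β : ℝ) (I : KnapsackInstance ι) : Finset ι :=
  if ∃ a : Fin I.n, β * I.capacity ≤ total I.value (I.opt (I.ofAgent a I.items)) then
    I.opt (I.ofAgent
      (argmax Finset.univ fun a : Fin I.n => total I.value (I.opt (I.ofAgent a I.items))) I.items)
  else I.restrictedGreedy I.restrictedSet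

end KnapsackInstance

/-- A deterministic mechanism: a map from instances to feasible packings. It sees only the
reported items: the packing is determined by the number of agents, the capacity, the reported set
of items and the owners, values and sizes of these items. -/
structure DetMechanism (ι : Type*) where
  pack : KnapsackInstance ι → Finset ι
  pack_subset : ∀ I, pack I ⊆ I.items
  pack_feasible : ∀ I, total I.size (pack I) ≤ I.capacity
  pack_congr : ∀ I J, I.SameData J → pack I = pack J

namespace DetMechanism

variable {ι : Type*}

/-- No agent gains by hiding some of the own items, on instances of the class `𝓘`. -/
def StrategyproofOn [DecidableEq ι] (M : DetMechanism ι) (𝓘 : Set (KnapsackInstance ι)) : Prop :=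
  ∀ I ∈ 𝓘, ∀ (a : Fin I.n) (E' : Finset ι) (h : E' ⊆ I.items),
    I.items \ E' ⊆ I.ofAgent a I.items →
      I.agentValue a (M.pack (I.restrict E' h)) ≤ I.agentValue a (M.pack I)

/-- The packing is worth at least `α` times the optimum, on instances of the class `𝓘`. -/
def ApproximateOn (M : DetMechanism ι) (α : ℝ) (𝓘 : Set (KnapsackInstance ι)) : Prop :=
  ∀ I ∈ 𝓘, α * total I.value (I.opt I.items) ≤ total I.value (M.pack I)

end DetMechanism

/-! ### Weighted sums, telescoping and the gain function -/

section Total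

variable {ι : Type*}

/-! With unit density the greedy order is decreasing value, and an item preceded by total value `b`
receives `gain C b v = min C (b + v) - min C b`. This is antitone in `b` and telescopes over `Q` to
`min C (v(Q))`. So a quota can be read in two ways: as the sum of the agent's own gains, or as what
the gains of the others leave of that minimum.

Strategyproofness. If some agent reaches `βC`, hiding only lowers the hider's own optimum and cannot
take the win from another agent; ties are excluded because feasible packings have distinct values.
Otherwise an agent packs best within a quota, so it suffices that hiding one item `k` does not raise
the owner's quota (`quota_restrictedSet_erase_le`). Let `i*` change from `s` to `t`. If `t = s`,
then `R` loses at most `k`. If `t` is less valuable, then `k = s`, and `R` either just loses `s` or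
has `s` replaced by the lighter `t`, with no further item entering; this is where `β ≤ 2/3` is
needed (`add_le_of_exchange`). If `t` is more valuable, it belongs to another agent and does not fit
with `k`; packing `t` first leaves less than `v_k`, which `k` alone earned if it was in `R`, and if
it was not, the owner's items only move behind heavier ones.

Approximation. If `R` overflows, two items larger than the first cut one are packed, which fills
`2/3` of the capacity. Otherwise all of `R` counts. An optimum `O` not inside `R` misses `i*`, and
`O \ R` belongs to one agent, so `v(O) ≤ v(R) - v_{i*} + βC`, while `v_{i*} ≥ (1 - β)C`. Together
these give the ratio `(1 - β)/β`. -/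

theorem total_le_total {w : ι → ℝ} {A B : Finset ι} (h : A ⊆ B) (hw : ∀ i ∈ B, 0 ≤ w i) :
    total w A ≤ total w B :=
  Finset.sum_le_sum_of_subset_of_nonneg h fun i hi _ => hw i hi

theorem total_nonneg {w : ι → ℝ} {A : Finset ι} (hw : ∀ i ∈ A, 0 ≤ w i) : 0 ≤ total w A :=
  Finset.sum_nonneg hw

theorem total_congr {w w' : ι → ℝ} {A : Finset ι} (h : ∀ i ∈ A, w i = w' i) :
    total w A = total w' A :=
  Finset.sum_congr rfl h

theorem weight_le_total {w : ι → ℝ} {A : Finset ι} {i : ι} (hi : i ∈ A) (hw : ∀ i ∈ A, 0 ≤ w i) :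
    w i ≤ total w A :=
  Finset.single_le_sum hw hi

/-- If `A` arises from a subset of `B` by exchanging `t` for a lighter item `s`, then `A` is
lighter than `B`. -/
theorem total_le_total_of_exchange [DecidableEq ι] {w : ι → ℝ} {A B : Finset ι} {s t : ι}
    (ht : t ∈ B) (hst : w s ≤ w t) (hs : 0 ≤ w s) (hAB : ∀ j ∈ A, j ≠ s → j ∈ B.erase t)
    (hw : ∀ i ∈ B, 0 ≤ w i) : total w A ≤ total w B := by
  have hw' : ∀ i ∈ insert s (B.erase t), 0 ≤ w i := by
    intro i hi
    rcases Finset.mem_insert.1 hi with rfl | hi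
    · exact hs
    · exact hw i (Finset.mem_of_mem_erase hi)
  have h1 : total w A ≤ total w (insert s (B.erase t)) := by
    refine total_le_total (fun j hj => ?_) hw'
    by_cases hjs : j = s
    · simp [hjs]
    · exact Finset.mem_insert_of_mem (hAB j hj hjs)
  have h2 : total w (insert s (B.erase t)) ≤ w s + total w (B.erase t) := by
    by_cases hmem : s ∈ B.erase t
    · rw [Finset.insert_eq_of_mem hmem]
      linarith
    · exact (Finset.sum_insert hmem).le
  have h3 : w t + total w (B.erase t) = total w B := Finset.add_sum_erase B w ht
  linarith

/-- The elements of `Q` that are strictly heavier than `i`. -/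
noncomputable def above (w : ι → ℝ) (Q : Finset ι) (i : ι) : Finset ι :=
  Q.filter fun j => w i < w j

theorem mem_above {w : ι → ℝ} {Q : Finset ι} {i j : ι} : j ∈ above w Q i ↔ j ∈ Q ∧ w i < w j :=
  Finset.mem_filter

theorem above_subset (w : ι → ℝ) (Q : Finset ι) (i : ι) : above w Q i ⊆ Q :=
  Finset.filter_subset _ _

/-- Stacked by decreasing weight, the intervals `[b, b + w i]` tile `[0, total w Q]`; injectivity
keeps two items from sharing an interval. The induction adds the lightest item, which changes no
other `above` set. -/
theorem sum_above_telescope (w : ι → ℝ) (g : ℝ → ℝ) (Q : Finset ι) (hQ : Set.InjOn w Q) :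
    ∑ i ∈ Q, (g (total w (above w Q i) + w i) - g (total w (above w Q i))) =
      g (total w Q) - g 0 := by
  classical
  induction Q using Finset.induction_on_min_value w with
  | empty => simp [total]
  | insert a s ha hmin ih =>
    have hlt : ∀ x ∈ s, w a < w x := fun x hx =>
      lt_of_le_of_ne (hmin x hx) fun h => ha
        ((hQ (by simp) (by simp [hx]) h : a = x) ▸ hx)
    have h1 : above w (insert a s) a = s := by
      ext j
      rw [mem_above, Finset.mem_insert]
      constructor
      · rintro ⟨rfl | h, h'⟩
        · exact absurd h' (lt_irrefl _)
        · exact h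
      · exact fun h => ⟨Or.inr h, hlt j h⟩
    have h2 : ∀ i ∈ s, above w (insert a s) i = above w s i := by
      intro i hi
      ext j
      rw [mem_above, mem_above, Finset.mem_insert]
      constructor
      · rintro ⟨rfl | h, h'⟩
        · exact absurd h' (hlt i hi).not_gt
        · exact ⟨h, h'⟩
      · exact fun h => ⟨Or.inr h.1, h.2⟩
    have h3 : total w (insert a s) = total w s + w a := by
      rw [total, Finset.sum_insert ha, add_comm, total]
    rw [Finset.sum_insert ha, h1, h3,
      Finset.sum_congr rfl (fun i hi => by rw [h2 i hi]),
      ih (hQ.mono (by simp))]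
    ring

/-- The amount of an item of size `x` that is packed when the part `b` of the capacity `c` has
been requested before. -/
noncomputable def gain (c b x : ℝ) : ℝ := min c (b + x) - min c b

/-- This is concavity of `min c`. -/
theorem gain_anti {c b b' x : ℝ} (h : b ≤ b') (hx : 0 ≤ x) : gain c b' x ≤ gain c b x := by
  simp only [gain, min_def]
  split_ifs <;> linarith

theorem gain_nonneg {c b x : ℝ} (hx : 0 ≤ x) : 0 ≤ gain c b x :=
  sub_nonneg.2 (min_le_min_left _ (by linarith))

theorem gain_eq {c b x : ℝ} (hx : 0 ≤ x) (h : b + x ≤ c) : gain c b x = x := by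
  rw [gain, min_eq_right h, min_eq_right (by linarith)]
  ring

/-- `argmax` is a choice from a predicate, so equal predicates give the same choice even among ties.
-/
theorem argmax_congr {α : Type*} [Nonempty α] {S T : Finset α} {f g : α → ℝ} (h : S = T)
    (hfg : ∀ a ∈ S, f a = g a) : argmax S f = argmax T g := by
  subst h
  unfold argmax
  congr 1
  funext a
  refine propext (and_congr_right fun ha => forall₂_congr fun b hb => ?_)
  rw [hfg a ha, hfg b hb]

end Total

/-! ### Unit-density instances and optimal packings -/

namespace KnapsackInstance

variable {ι : Type*} {I : KnapsackInstance ι}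

theorem value_nonneg {D : Finset ι} (hD : D ⊆ I.items) : ∀ i ∈ D, 0 ≤ I.value i :=
  fun i hi => (I.value_pos i (hD hi)).le

theorem mem_ofAgent {a : Fin I.n} {D : Finset ι} {i : ι} :
    i ∈ I.ofAgent a D ↔ i ∈ D ∧ I.owner i = a :=
  Finset.mem_filter

theorem ofAgent_subset (a : Fin I.n) (D : Finset ι) : I.ofAgent a D ⊆ D :=
  Finset.filter_subset _ _

theorem ofAgent_subset_ofAgent (a : Fin I.n) {D D' : Finset ι} (h : D ⊆ D') :
    I.ofAgent a D ⊆ I.ofAgent a D' :=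
  Finset.filter_subset_filter _ h

theorem ofAgent_eq_self {a : Fin I.n} {D D' : Finset ι} (h : D ⊆ I.ofAgent a D') :
    I.ofAgent a D = D :=
  Finset.filter_true_of_mem fun _ hi => (mem_ofAgent.1 (h hi)).2

theorem sum_ofAgent (f : ι → ℝ) (D : Finset ι) : ∑ a, ∑ i ∈ I.ofAgent a D, f i = ∑ i ∈ D, f i :=
  Finset.sum_fiberwise D I.owner f

theorem size_eq_value (hI : I ∈ unitDensity ι) {i : ι} (hi : i ∈ I.items) :
    I.size i = I.value i :=
  ((div_eq_one_iff_eq (I.size_pos i hi).ne').1 (hI i hi)).symm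

theorem total_size_eq (hI : I ∈ unitDensity ι) {D : Finset ι} (hD : D ⊆ I.items) :
    total I.size D = total I.value D :=
  total_congr fun _ hi => size_eq_value hI (hD hi)

theorem value_le_capacity (hI : I ∈ unitDensity ι) {i : ι} (hi : i ∈ I.items) :
    I.value i ≤ I.capacity :=
  size_eq_value hI hi ▸ I.size_le i hi

theorem value_injOn {Q : Finset ι} (hQ : Q ⊆ I.items) : Set.InjOn I.value Q := by
  intro i hi j hj h
  by_contra hne
  exact I.value_inj i (hQ hi) j (hQ hj) hne h

theorem restrict_mem_unitDensity (hI : I ∈ unitDensity ι) {E' : Finset ι} (h : E' ⊆ I.items) :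
    I.restrict E' h ∈ unitDensity ι :=
  fun i hi => hI i (h hi)

/-- In a unit-density instance, distinct feasible packings have distinct values. -/
theorem eq_of_total_value_eq (hI : I ∈ unitDensity ι) {D D' : Finset ι} (hD : D ⊆ I.items)
    (hD' : D' ⊆ I.items) (hc : total I.value D ≤ I.capacity)
    (h : total I.value D = total I.value D') : D = D' := by
  -- Take the common value as the reduced capacity: value equals size, so nothing can exceed it and
  -- both packings are optimal.
  refine (I.opt_unique I.items subset_rfl (total I.value D)
    (total_nonneg (value_nonneg hD)) hc).unique ⟨⟨hD, (total_size_eq hI hD).le⟩, ?_⟩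
    ⟨⟨hD', by rw [total_size_eq hI hD', h]⟩, ?_⟩
  · intro D'' h'' hs
    rwa [← total_size_eq hI h'']
  · intro D'' h'' hs
    rwa [← h, ← total_size_eq hI h'']

section Opt

theorem opt_spec (I : KnapsackInstance ι) (D : Finset ι) :
    I.opt D ⊆ D ∧ total I.size (I.opt D) ≤ I.capacity ∧
      ∀ D', D' ⊆ D → total I.size D' ≤ I.capacity → total I.value D' ≤ total I.value (I.opt D) := by
  have h := argmax_spec (D.powerset.filter fun D' => total I.size D' ≤ I.capacity)
    (total I.value) ⟨∅, Finset.mem_filter.2 ⟨by simp, by simp [total, I.capacity_pos.le]⟩⟩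
  simp only [Finset.mem_filter, Finset.mem_powerset] at h
  exact ⟨h.1.1, h.1.2, fun D' h1 h2 => h.2 D' ⟨h1, h2⟩⟩

theorem opt_mono (I : KnapsackInstance ι) {D D' : Finset ι} (h : D ⊆ D') :
    total I.value (I.opt D) ≤ total I.value (I.opt D') :=
  (I.opt_spec D').2.2 _ ((I.opt_spec D).1.trans h) (I.opt_spec D).2.1

theorem total_opt_le (hI : I ∈ unitDensity ι) {D : Finset ι} (hD : D ⊆ I.items) :
    total I.value (I.opt D) ≤ I.capacity := by
  rw [← total_size_eq hI ((I.opt_spec D).1.trans hD)]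
  exact (I.opt_spec D).2.1

theorem le_total_opt (hI : I ∈ unitDensity ι) {D D' : Finset ι} (hD : D ⊆ I.items) (h : D' ⊆ D)
    (hc : total I.value D' ≤ I.capacity) : total I.value D' ≤ total I.value (I.opt D) :=
  (I.opt_spec D).2.2 D' h (by rwa [total_size_eq hI (h.trans hD)])

end Opt

/-! ### Quotas as sums of gains -/

section Quota

theorem greedyBefore_eq (hI : I ∈ unitDensity ι) {Q : Finset ι} (hQ : Q ⊆ I.items) {i : ι}
    (hi : i ∈ Q) : I.greedyBefore Q i = above I.value Q i := by
  refine Finset.filter_congr fun j hj => ?_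
  rw [hI i (hQ hi), hI j (hQ hj)]
  simp

theorem value_mul_greedyFrac (hI : I ∈ unitDensity ι) {Q : Finset ι} (hQ : Q ⊆ I.items) {i : ι}
    (hi : i ∈ Q) : I.value i * I.greedyFrac Q i =
      gain I.capacity (total I.value (above I.value Q i)) (I.value i) := by
  have hpos := I.value_pos i (hQ hi)
  rw [greedyFrac, greedyBefore_eq hI hQ hi, size_eq_value hI (hQ hi),
    total_size_eq hI ((above_subset _ _ _).trans hQ)]
  have hdiv : I.value i * ((I.capacity - total I.value (above I.value Q i)) / I.value i) =
      I.capacity - total I.value (above I.value Q i) := by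
    field_simp
  simp only [gain, min_def]
  split_ifs <;> linarith

theorem quota_eq (hI : I ∈ unitDensity ι) {Q : Finset ι} (hQ : Q ⊆ I.items) (a : Fin I.n) :
    I.quota Q a = ∑ i ∈ I.ofAgent a Q,
      gain I.capacity (total I.value (above I.value Q i)) (I.value i) :=
  Finset.sum_congr rfl fun _ hi => value_mul_greedyFrac hI hQ (ofAgent_subset a Q hi)

theorem sum_gain (I : KnapsackInstance ι) {Q : Finset ι} (hQ : Q ⊆ I.items) :
    ∑ i ∈ Q, gain I.capacity (total I.value (above I.value Q i)) (I.value i) =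
      min I.capacity (total I.value Q) := by
  have h := sum_above_telescope I.value (fun x => min I.capacity x) Q (value_injOn hQ)
  simp only [min_eq_right I.capacity_pos.le, sub_zero] at h
  exact h

/-- The second reading of the quota: what the other agents leave over. -/
theorem quota_add_others (hI : I ∈ unitDensity ι) {Q : Finset ι} (hQ : Q ⊆ I.items)
    (a : Fin I.n) :
    I.quota Q a + ∑ i ∈ Q.filter (fun i => ¬ I.owner i = a),
      gain I.capacity (total I.value (above I.value Q i)) (I.value i) =
      min I.capacity (total I.value Q) := by
  rw [quota_eq hI hQ, ← sum_gain I hQ]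
  exact Finset.sum_filter_add_sum_filter_not _ _ _

theorem quota_nonneg (hI : I ∈ unitDensity ι) {Q : Finset ι} (hQ : Q ⊆ I.items) (a : Fin I.n) :
    0 ≤ I.quota Q a := by
  rw [quota_eq hI hQ]
  exact Finset.sum_nonneg fun i hi => gain_nonneg (value_nonneg hQ i (ofAgent_subset a Q hi))

/-- Comparison through the agent's own items: each survives and is preceded by no more weight. -/
theorem quota_le_quota (hI : I ∈ unitDensity ι) {Q Q' : Finset ι} (hQ : Q ⊆ I.items)
    (hQ' : Q' ⊆ I.items) {a : Fin I.n}
    (h : ∀ i ∈ Q', I.owner i = a → i ∈ Q ∧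
      total I.value (above I.value Q i) ≤ total I.value (above I.value Q' i)) :
    I.quota Q' a ≤ I.quota Q a := by
  rw [quota_eq hI hQ, quota_eq hI hQ']
  refine (Finset.sum_le_sum fun i hi => ?_).trans
    (Finset.sum_le_sum_of_subset_of_nonneg (fun i hi => ?_) fun i hi _ =>
      gain_nonneg (value_nonneg hQ i (ofAgent_subset a Q hi)))
  · obtain ⟨hi, ho⟩ := mem_ofAgent.1 hi
    exact gain_anti (h i hi ho).2 (value_nonneg hQ' i hi)
  · obtain ⟨hi, ho⟩ := mem_ofAgent.1 hi
    exact mem_ofAgent.2 ⟨(h i hi ho).1, ho⟩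

/-- Comparison through the complement: the others gain at least as much in `Q'`, and there is no
more to distribute. -/
theorem quota_le_quota_of_others (hI : I ∈ unitDensity ι) {Q Q' : Finset ι} (hQ : Q ⊆ I.items)
    (hQ' : Q' ⊆ I.items) {a : Fin I.n} (htot : total I.value Q' ≤ total I.value Q)
    (h : ∀ i ∈ Q, I.owner i ≠ a → i ∈ Q' ∧
      total I.value (above I.value Q' i) ≤ total I.value (above I.value Q i)) :
    I.quota Q' a ≤ I.quota Q a := by
  have h1 := quota_add_others hI hQ a
  have h2 := quota_add_others hI hQ' a
  have h3 : min I.capacity (total I.value Q') ≤ min I.capacity (total I.value Q) :=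
    min_le_min_left _ htot
  have h4 : ∑ i ∈ Q.filter (fun i => ¬ I.owner i = a),
        gain I.capacity (total I.value (above I.value Q i)) (I.value i) ≤
      ∑ i ∈ Q'.filter (fun i => ¬ I.owner i = a),
        gain I.capacity (total I.value (above I.value Q' i)) (I.value i) := by
    refine (Finset.sum_le_sum fun i hi => ?_).trans
      (Finset.sum_le_sum_of_subset_of_nonneg (fun i hi => ?_) fun i hi _ =>
        gain_nonneg (value_nonneg hQ' i (Finset.mem_filter.1 hi).1))
    · obtain ⟨hi, ho⟩ := Finset.mem_filter.1 hi
      exact gain_anti (h i hi ho).2 (value_nonneg hQ i hi)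
    · obtain ⟨hi, ho⟩ := Finset.mem_filter.1 hi
      exact Finset.mem_filter.2 ⟨(h i hi ho).1, ho⟩
  linarith

theorem quota_le_capacity_sub (hI : I ∈ unitDensity ι) {Q : Finset ι} (hQ : Q ⊆ I.items)
    {a : Fin I.n} {t : ι} (ht : t ∈ Q) (ho : I.owner t ≠ a)
    (hc : total I.value (above I.value Q t) + I.value t ≤ I.capacity) :
    I.quota Q a ≤ I.capacity - I.value t := by
  have h1 := quota_add_others hI hQ a
  have h2 : gain I.capacity (total I.value (above I.value Q t)) (I.value t) ≤
      ∑ i ∈ Q.filter (fun i => ¬ I.owner i = a),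
        gain I.capacity (total I.value (above I.value Q i)) (I.value i) :=
    Finset.single_le_sum
      (f := fun i => gain I.capacity (total I.value (above I.value Q i)) (I.value i))
      (fun i hi => gain_nonneg (value_nonneg hQ i (Finset.mem_filter.1 hi).1))
      (Finset.mem_filter.2 ⟨ht, ho⟩)
  rw [gain_eq (value_nonneg hQ t ht) hc] at h2
  have h3 := min_le_left I.capacity (total I.value Q)
  linarith

theorem total_ofAgent_le_quota (hI : I ∈ unitDensity ι) {Q F : Finset ι} (hQ : Q ⊆ I.items)
    (hF : F ⊆ Q)
    (hc : ∀ i ∈ F, total I.value (above I.value Q i) + I.value i ≤ I.capacity) (a : Fin I.n) :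
    total I.value (I.ofAgent a F) ≤ I.quota Q a := by
  rw [quota_eq hI hQ]
  refine (Finset.sum_le_sum fun i hi => ?_).trans
    (Finset.sum_le_sum_of_subset_of_nonneg (ofAgent_subset_ofAgent a hF) fun i hi _ =>
      gain_nonneg (value_nonneg hQ i (ofAgent_subset a Q hi)))
  have hiF := ofAgent_subset a F hi
  exact (gain_eq (value_nonneg hQ i (hF hiF)) (hc i hiF)).ge

end Quota

/-! ### Shares and feasibility of RestrictedGreedy -/

section RestrictedGreedy

/-- What agent `a` packs in RestrictedGreedy. -/
noncomputable def share (I : KnapsackInstance ι) (Q : Finset ι) (a : Fin I.n) : Finset ι :=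
  argmax ((I.ofAgent a I.items).powerset.filter fun D => total I.value D ≤ I.quota Q a)
    (total I.value)

theorem share_spec (hI : I ∈ unitDensity ι) {Q : Finset ι} (hQ : Q ⊆ I.items) (a : Fin I.n) :
    I.share Q a ⊆ I.ofAgent a I.items ∧ total I.value (I.share Q a) ≤ I.quota Q a ∧
      ∀ D, D ⊆ I.ofAgent a I.items → total I.value D ≤ I.quota Q a →
        total I.value D ≤ total I.value (I.share Q a) := by
  have h := argmax_spec
    ((I.ofAgent a I.items).powerset.filter fun D => total I.value D ≤ I.quota Q a)
    (total I.value) ⟨∅, Finset.mem_filter.2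
      ⟨by simp, by simpa [total] using quota_nonneg hI hQ a⟩⟩
  simp only [Finset.mem_filter, Finset.mem_powerset] at h
  exact ⟨h.1.1, h.1.2, fun D' h1 h2 => h.2 D' ⟨h1, h2⟩⟩

variable [DecidableEq ι]

theorem restrictedGreedy_eq (I : KnapsackInstance ι) (Q : Finset ι) :
    I.restrictedGreedy Q = Finset.univ.biUnion (I.share Q) :=
  rfl

theorem restrictedGreedy_subset (hI : I ∈ unitDensity ι) {Q : Finset ι} (hQ : Q ⊆ I.items) :
    I.restrictedGreedy Q ⊆ I.items := by
  rw [restrictedGreedy_eq]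
  exact Finset.biUnion_subset.2 fun a _ => (share_spec hI hQ a).1.trans (ofAgent_subset _ _)

theorem ofAgent_restrictedGreedy (hI : I ∈ unitDensity ι) {Q : Finset ι} (hQ : Q ⊆ I.items)
    (a : Fin I.n) : I.ofAgent a (I.restrictedGreedy Q) = I.share Q a := by
  ext i
  rw [mem_ofAgent, restrictedGreedy_eq, Finset.mem_biUnion]
  constructor
  · rintro ⟨⟨b, -, hb⟩, rfl⟩
    rwa [(mem_ofAgent.1 ((share_spec hI hQ b).1 hb)).2]
  · exact fun h => ⟨⟨a, Finset.mem_univ a, h⟩, (mem_ofAgent.1 ((share_spec hI hQ a).1 h)).2⟩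

theorem total_restrictedGreedy (hI : I ∈ unitDensity ι) {Q : Finset ι} (hQ : Q ⊆ I.items) :
    total I.value (I.restrictedGreedy Q) = ∑ a, total I.value (I.share Q a) := by
  rw [total, ← sum_ofAgent]
  exact Finset.sum_congr rfl fun a _ => by rw [ofAgent_restrictedGreedy hI hQ, total]

theorem total_restrictedGreedy_le (hI : I ∈ unitDensity ι) {Q : Finset ι} (hQ : Q ⊆ I.items) :
    total I.value (I.restrictedGreedy Q) ≤ I.capacity := by
  rw [total_restrictedGreedy hI hQ]
  calc ∑ a, total I.value (I.share Q a) ≤ ∑ a, I.quota Q a :=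
        Finset.sum_le_sum fun a _ => (share_spec hI hQ a).2.1
    _ = ∑ i ∈ Q, I.value i * I.greedyFrac Q i := sum_ofAgent _ _
    _ = ∑ i ∈ Q, gain I.capacity (total I.value (above I.value Q i)) (I.value i) :=
        Finset.sum_congr rfl fun i hi => value_mul_greedyFrac hI hQ hi
    _ ≤ I.capacity := by
        rw [sum_gain I hQ]
        exact min_le_left _ _

/-- RestrictedGreedy is worth at least as much as the items that are packed completely. -/
theorem le_total_restrictedGreedy (hI : I ∈ unitDensity ι) {Q F : Finset ι} (hQ : Q ⊆ I.items)
    (hF : F ⊆ Q)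
    (hc : ∀ i ∈ F, total I.value (above I.value Q i) + I.value i ≤ I.capacity) :
    total I.value F ≤ total I.value (I.restrictedGreedy Q) := by
  rw [total_restrictedGreedy hI hQ, total, ← sum_ofAgent (I := I)]
  exact Finset.sum_le_sum fun a _ => (share_spec hI hQ a).2.2 _
    (ofAgent_subset_ofAgent a (hF.trans hQ)) (total_ofAgent_le_quota hI hQ hF hc a)

end RestrictedGreedy

end KnapsackInstance

namespace KnapsackInstance

variable {ι : Type*} {I : KnapsackInstance ι}

/-! ### The item `i*` and the restricted set -/

section Star

theorem mem_fitSet {i : ι} : i ∈ I.fitSet ↔ i ∈ I.items ∧ ∀ j ∈ I.items,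
    I.owner j ≠ I.owner i → I.value j < I.value i → I.value i + I.value j ≤ I.capacity :=
  Finset.mem_filter

theorem eq_of_value_eq {i j : ι} (hi : i ∈ I.items) (hj : j ∈ I.items)
    (h : I.value i = I.value j) : i = j :=
  value_injOn subset_rfl hi hj h

theorem IsStar.mem {s : ι} (hs : I.IsStar s) : s ∈ I.items :=
  (mem_fitSet.1 hs.1).1

theorem IsStar.unique {s t : ι} (hs : I.IsStar s) (ht : I.IsStar t) : s = t :=
  eq_of_value_eq hs.mem ht.mem (le_antisymm (ht.2 s hs.1) (hs.2 t ht.1))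

theorem exists_isStar (h : I.items.Nonempty) : ∃ s, I.IsStar s := by
  -- The least valuable item lies in `P` vacuously.
  obtain ⟨m, hm, hmin⟩ := I.items.exists_min_image I.value h
  have hne : I.fitSet.Nonempty :=
    ⟨m, mem_fitSet.2 ⟨hm, fun j hj _ hlt => absurd (hmin j hj) hlt.not_ge⟩⟩
  obtain ⟨s, hs, hmax⟩ := I.fitSet.exists_max_image I.value hne
  exact ⟨s, hs, hmax⟩

theorem IsStar.mem_restrictedSet_iff {s : ι} (hs : I.IsStar s) {i : ι} :
    i ∈ I.restrictedSet ↔ i ∈ I.items ∧ (i = s ∨ I.value s + I.value i ≤ I.capacity) := by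
  simp only [restrictedSet, Finset.mem_filter]
  refine and_congr_right fun _ => ⟨?_, ?_⟩
  · rintro (h | ⟨k, hk, h⟩)
    · exact Or.inl (h.unique hs)
    · exact Or.inr (hk.unique hs ▸ h)
  · rintro (rfl | h)
    · exact Or.inl hs
    · exact Or.inr ⟨s, hs, h⟩

theorem restrictedSet_subset (I : KnapsackInstance ι) : I.restrictedSet ⊆ I.items := by
  classical exact Finset.filter_subset _ _

theorem IsStar.mem_restrictedSet {s : ι} (hs : I.IsStar s) : s ∈ I.restrictedSet :=
  hs.mem_restrictedSet_iff.2 ⟨hs.mem, Or.inl rfl⟩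

/-- An item that fits together with `i*` is not more valuable than `i*`. -/
theorem IsStar.value_le {s : ι} (hs : I.IsStar s) {i : ι} (hi : i ∈ I.items)
    (h : I.value s + I.value i ≤ I.capacity) : I.value i ≤ I.value s := by
  by_contra! hlt
  -- The least valuable item `m` above `s` would lie in `P`: smaller items are at most `s`, and `m`
  -- is at most `i`, which fits with `s`.
  obtain ⟨m, hm, hmin⟩ := (I.items.filter fun j => I.value s < I.value j).exists_min_image I.value
    ⟨i, Finset.mem_filter.2 ⟨hi, hlt⟩⟩
  obtain ⟨hmE, hsm⟩ := Finset.mem_filter.1 hm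
  refine hsm.not_ge (hs.2 m (mem_fitSet.2 ⟨hmE, fun j hj _ hjm => ?_⟩))
  have h1 : I.value j ≤ I.value s := by
    by_contra! hjs
    exact hjm.not_ge (hmin j (Finset.mem_filter.2 ⟨hj, hjs⟩))
  have h2 := hmin i (Finset.mem_filter.2 ⟨hi, hlt⟩)
  linarith

theorem IsStar.value_le_of_mem {s : ι} (hs : I.IsStar s) {i : ι} (hi : i ∈ I.restrictedSet) :
    I.value i ≤ I.value s := by
  obtain ⟨hE, rfl | h⟩ := hs.mem_restrictedSet_iff.1 hi
  · exact le_rfl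
  · exact hs.value_le hE h

theorem IsStar.add_le_of_mem {s : ι} (hs : I.IsStar s) {i : ι} (hi : i ∈ I.restrictedSet)
    (hne : i ≠ s) : I.value s + I.value i ≤ I.capacity :=
  (hs.mem_restrictedSet_iff.1 hi).2.resolve_left hne

theorem IsStar.mem_above {s : ι} (hs : I.IsStar s) {i : ι} (hi : i ∈ I.restrictedSet)
    (hne : i ≠ s) : s ∈ above I.value I.restrictedSet i :=
  _root_.mem_above.2 ⟨hs.mem_restrictedSet, lt_of_le_of_ne (hs.value_le_of_mem hi)
    fun h => hne (eq_of_value_eq (restrictedSet_subset I hi) hs.mem h)⟩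

theorem IsStar.above_eq_empty {s : ι} (hs : I.IsStar s) :
    above I.value I.restrictedSet s = ∅ :=
  Finset.filter_eq_empty_iff.2 fun _ hj => (hs.value_le_of_mem hj).not_gt

theorem IsStar.fits {s : ι} (hI : I ∈ unitDensity ι) (hs : I.IsStar s) :
    total I.value (above I.value I.restrictedSet s) + I.value s ≤ I.capacity := by
  rw [hs.above_eq_empty]
  simpa [total] using value_le_capacity hI hs.mem

end Star

/-! ### Hiding one item does not raise the quota -/

section Erase

theorem value_lt_of_small {β : ℝ} (hI : I ∈ unitDensity ι)
    (hsmall : ∀ a, total I.value (I.opt (I.ofAgent a I.items)) < β * I.capacity) {i : ι}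
    (hi : i ∈ I.items) : I.value i < β * I.capacity := by
  have hp : total I.value {i} = I.value i := Finset.sum_singleton _ _
  rw [← hp]
  refine (le_total_opt hI (ofAgent_subset (I.owner i) I.items) (fun k hk => ?_)
    (by rw [hp]; exact value_le_capacity hI hi)).trans_lt (hsmall (I.owner i))
  rw [Finset.mem_singleton.1 hk]
  exact mem_ofAgent.2 ⟨hi, rfl⟩

variable [DecidableEq ι]

/-- Two items of the same agent that fit together are worth less than `β C` if all packings of
single agents are. -/
theorem add_lt_of_owner_eq {β : ℝ} (hI : I ∈ unitDensity ι)
    (hsmall : ∀ a, total I.value (I.opt (I.ofAgent a I.items)) < β * I.capacity) {i j : ι}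
    (hi : i ∈ I.items) (hj : j ∈ I.items) (hij : i ≠ j) (ho : I.owner i = I.owner j)
    (hc : I.value i + I.value j ≤ I.capacity) :
    I.value i + I.value j < β * I.capacity := by
  have hp : total I.value {i, j} = I.value i + I.value j := Finset.sum_pair hij
  rw [← hp] at hc ⊢
  refine (le_total_opt hI (ofAgent_subset (I.owner j) I.items) (fun k hk => ?_) hc).trans_lt
    (hsmall (I.owner j))
  rcases Finset.mem_insert.1 hk with rfl | hk
  · exact mem_ofAgent.2 ⟨hi, ho⟩
  · rw [Finset.mem_singleton.1 hk]
    exact mem_ofAgent.2 ⟨hj, rfl⟩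

/-- Exchanging `t` for a less valuable item `s` of the same agent does not admit further items
into the restricted set, provided that `t` fits with all less valuable items of other agents. -/
theorem add_le_of_exchange {β : ℝ} (hI : I ∈ unitDensity ι) (hβ : β ≤ 2 / 3)
    (hsmall : ∀ a, total I.value (I.opt (I.ofAgent a I.items)) < β * I.capacity) {s t j : ι}
    (hs : s ∈ I.items) (ht : t ∈ I.items) (hj : j ∈ I.items) (hst : I.value s < I.value t)
    (hc : I.capacity < I.value s + I.value t) (ho : I.owner s = I.owner t) (hjs : j ≠ s)
    (hjle : I.value j ≤ I.value s) (hjc : I.value s + I.value j ≤ I.capacity)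
    (hfit : I.owner j ≠ I.owner t → I.value j < I.value t → I.value t + I.value j ≤ I.capacity) :
    I.value t + I.value j ≤ I.capacity := by
  by_cases hjo : I.owner j = I.owner t
  · by_contra! hlt
    -- Adding the two overflows gives `2C < 2 v_t + (v_s + v_j) < 3βC ≤ 2C`.
    have h1 := add_lt_of_owner_eq hI hsmall hs hj hjs.symm (ho.trans hjo.symm) hjc
    have h2 := value_lt_of_small hI hsmall ht
    have h3 := mul_le_mul_of_nonneg_right hβ I.capacity_pos.le
    linarith
  · exact hfit hjo (by linarith)

/-- Hiding an item does not increase the quota of its owner. -/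
theorem quota_restrictedSet_erase_le {β : ℝ} (hI : I ∈ unitDensity ι) (hβ : β ≤ 2 / 3)
    (hsmall : ∀ a, total I.value (I.opt (I.ofAgent a I.items)) < β * I.capacity) {k : ι}
    (hk : k ∈ I.items) {E' : Finset ι} (h : E' ⊆ I.items) (hE' : E' = I.items.erase k) :
    I.quota (I.restrict E' h).restrictedSet (I.owner k) ≤
      I.quota I.restrictedSet (I.owner k) := by
  have hmemE' : ∀ {i}, i ∈ E' ↔ i ≠ k ∧ i ∈ I.items := by
    intro i
    rw [hE', Finset.mem_erase]
  set J := I.restrict E' h with hJ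
  have hQ := restrictedSet_subset I
  have hQ' : J.restrictedSet ⊆ I.items := (restrictedSet_subset J).trans h
  rcases E'.eq_empty_or_nonempty with hemp | hne
  · have hR : J.restrictedSet = ∅ :=
      Finset.subset_empty.1 (hemp ▸ restrictedSet_subset J)
    rw [hR]
    refine le_trans (le_of_eq ?_) (quota_nonneg hI hQ _)
    simp [quota, ofAgent]
  obtain ⟨s, hs⟩ := exists_isStar ⟨k, hk⟩
  obtain ⟨t, ht⟩ := exists_isStar (I := J) hne
  have hJI : J ∈ unitDensity ι := restrict_mem_unitDensity hI h
  have hmem : ∀ {i}, i ∈ I.restrictedSet ↔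
      i ∈ I.items ∧ (i = s ∨ I.value s + I.value i ≤ I.capacity) :=
    hs.mem_restrictedSet_iff
  have hmem' : ∀ {i}, i ∈ J.restrictedSet ↔
      i ∈ E' ∧ (i = t ∨ I.value t + I.value i ≤ I.capacity) :=
    ht.mem_restrictedSet_iff
  have htE' : t ∈ E' := ht.mem
  have hsE := hs.mem
  obtain ⟨htk, htE⟩ := hmemE'.1 htE'
  -- hiding an item keeps the other items in the set of fitting items
  have hfit : ∀ i ∈ I.fitSet, i ≠ k → i ∈ J.fitSet := fun i hi hik => by
    obtain ⟨h1, h2⟩ := mem_fitSet.1 hi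
    exact mem_fitSet.2 ⟨hmemE'.2 ⟨hik, h1⟩, fun j hj => h2 j (h hj)⟩
  have htfit : ∀ j ∈ E', I.owner j ≠ I.owner t → I.value j < I.value t →
      I.value t + I.value j ≤ I.capacity := (mem_fitSet.1 ht.1).2
  have hsfit : ∀ j ∈ I.items, I.owner j ≠ I.owner s → I.value j < I.value s →
      I.value s + I.value j ≤ I.capacity := (mem_fitSet.1 hs.1).2
  -- If only `k` disappears, the total drops and the other agents' items move forward, so the
  -- complement comparison applies.
  have herase : J.restrictedSet = I.restrictedSet.erase k →
      I.quota J.restrictedSet (I.owner k) ≤ I.quota I.restrictedSet (I.owner k) := by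
    intro hR
    have hsub : J.restrictedSet ⊆ I.restrictedSet := hR ▸ Finset.erase_subset _ _
    refine quota_le_quota_of_others hI hQ hQ' (total_le_total hsub (value_nonneg hQ))
      fun i hi ho => ⟨?_, ?_⟩
    · rw [hR]
      exact Finset.mem_erase.2 ⟨fun hik => ho (hik ▸ rfl), hi⟩
    · exact total_le_total (Finset.filter_subset_filter _ hsub)
        (value_nonneg ((above_subset _ _ _).trans hQ))
  rcases eq_or_ne t s with rfl | hts
  · refine herase (Finset.ext fun i => ?_)
    rw [Finset.mem_erase, hmem, hmem', hmemE', and_assoc]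
  rcases lt_or_gt_of_ne (fun hv => hts (eq_of_value_eq htE hsE hv)) with hlt | hlt
  · -- the new star is less valuable, so the hidden item is the old one
    have hsk : s = k := by
      by_contra hsk
      exact hlt.not_ge (ht.2 s (hfit s hs.1 hsk))
    subst hsk
    -- If the two stars fit together, an item other than `s` fits with one exactly when it is `t` or
    -- fits with the other, so `R` only loses `s`.
    by_cases hc : I.value t + I.value s ≤ I.capacity
    · refine herase (Finset.ext fun i => ?_)
      rw [Finset.mem_erase, hmem, hmem', hmemE', and_assoc]
      refine and_congr_right fun his => and_congr_right fun hiE => ?_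
      constructor
      · rintro (rfl | hi)
        · right
          linarith
        · right
          have h1 : I.value i ≤ I.value t := ht.value_le (hmemE'.2 ⟨his, hiE⟩) hi
          linarith
      · rintro (hi | hi)
        · exact absurd hi his
        · right
          linarith
    · push Not at hc
      -- Since `s` is in `P`, only an item of the same owner can be smaller and fail to fit.
      have ho : I.owner t = I.owner s := by
        by_contra ho
        linarith [hsfit t htE ho hlt]
      have hsub : ∀ j ∈ J.restrictedSet, j ≠ t → j ∈ I.restrictedSet.erase s := by
        intro j hj hjt
        have hjs := (hmemE'.1 (hmem'.1 hj).1).1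
        exact Finset.mem_erase.2 ⟨hjs, hmem.2 ⟨hQ' hj, Or.inr
          (add_le_of_exchange hI hβ hsmall htE hsE (hQ' hj) hlt hc ho hjt
            (ht.value_le_of_mem hj) (ht.add_le_of_mem hj hjt) (hsfit j (hQ' hj)))⟩⟩
      refine quota_le_quota_of_others hI hQ hQ'
        (total_le_total_of_exchange hs.mem_restrictedSet hlt.le (I.value_pos t htE).le hsub
          (value_nonneg hQ)) fun i hi hio => ⟨?_, ?_⟩
      · have his : i ≠ s := fun h' => hio (h' ▸ rfl)
        have h1 := hs.add_le_of_mem hi his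
        exact hmem'.2 ⟨hmemE'.2 ⟨his, hQ hi⟩, Or.inr (by linarith)⟩
      · have his : i ≠ s := fun h' => hio (h' ▸ rfl)
        refine total_le_total_of_exchange (hs.mem_above hi his) hlt.le (I.value_pos t htE).le
          (fun j hj hjt => ?_) (value_nonneg ((above_subset _ _ _).trans hQ))
        obtain ⟨hj, hij⟩ := mem_above.1 hj
        obtain ⟨hjs, hj⟩ := Finset.mem_erase.1 (hsub j hj hjt)
        exact Finset.mem_erase.2 ⟨hjs, mem_above.2 ⟨hj, hij⟩⟩
  · -- the new star is more valuable, so the hidden item has kept it from fitting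
    have hto : I.owner t ≠ I.owner k ∧ I.capacity < I.value t + I.value k := by
      by_contra hcon
      refine hlt.not_ge (hs.2 t (mem_fitSet.2 ⟨htE, fun j hj hjo hjt => ?_⟩))
      by_cases hjk : j = k
      · subst hjk
        by_contra! hlt'
        exact hcon ⟨hjo.symm, hlt'⟩
      · exact htfit j (hmemE'.2 ⟨hjk, hj⟩) hjo hjt
    have hc : I.capacity < I.value s + I.value t := by
      by_contra! hc
      exact hlt.not_ge (hs.value_le htE hc)
    -- The new star heads the greedy order and is packed whole for another agent; by `hto` the
    -- remainder is below `v_k`.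
    have hle : I.quota J.restrictedSet (I.owner k) ≤ I.capacity - I.value t :=
      quota_le_capacity_sub hI hQ' ht.mem_restrictedSet hto.1 (ht.fits hJI)
    have hsub : s ≠ k → ∀ j ∈ I.restrictedSet, j ≠ s → j ≠ k → j ∈ J.restrictedSet.erase t := by
      intro hsk j hj hjs hjk
      have hjE' := hmemE'.2 ⟨hjk, hQ hj⟩
      have ho : I.owner s = I.owner t := by
        by_contra ho
        linarith [htfit s (hmemE'.2 ⟨hsk, hsE⟩) ho hlt]
      refine Finset.mem_erase.2 ⟨fun hjt => ?_, hmem'.2 ⟨hjE', Or.inr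
        (add_le_of_exchange hI hβ hsmall hsE htE (hQ hj) hlt hc ho hjs
          (hs.value_le_of_mem hj) (hs.add_le_of_mem hj hjs) (htfit j hjE'))⟩⟩
      exact hlt.not_ge (hjt ▸ hs.value_le_of_mem hj)
    by_cases hkR : k ∈ I.restrictedSet
    -- Only `s` can precede `k`: any other predecessor would fit with `t`, although it is larger
    -- than `k`, which does not.
    · have hfits : total I.value (above I.value I.restrictedSet k) + I.value k ≤ I.capacity := by
        by_cases hsk : s = k
        · exact hsk ▸ hs.fits hI
        · have h1 : above I.value I.restrictedSet k ⊆ {s} := by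
            intro j hj
            obtain ⟨hj, hkj⟩ := mem_above.1 hj
            by_contra hjs
            have hjs' : j ≠ s := fun h' => hjs (Finset.mem_singleton.2 h')
            have hjR := hsub hsk j hj hjs' fun h' => hkj.ne (h' ▸ rfl)
            have := ht.add_le_of_mem (Finset.mem_of_mem_erase hjR) (Finset.ne_of_mem_erase hjR)
            have h2 : I.value t + I.value j ≤ I.capacity := this
            linarith [hto.2]
          have h2 : total I.value (above I.value I.restrictedSet k) ≤ total I.value {s} :=
            total_le_total h1 (by simpa using (I.value_pos s hsE).le)
          have h3 : total I.value {s} = I.value s := Finset.sum_singleton _ _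
          have h4 := hs.add_le_of_mem hkR (Ne.symm hsk)
          linarith
      have h1 := total_ofAgent_le_quota hI hQ (Finset.singleton_subset_iff.2 hkR)
        (by simpa using hfits) (I.owner k)
      have h2 : total I.value (I.ofAgent (I.owner k) {k}) = I.value k := by
        simp [total, ofAgent, Finset.filter_singleton]
      linarith [hto.2]
    · have hsk : s ≠ k := fun h' => hkR (h' ▸ hs.mem_restrictedSet)
      -- Before hiding, the owner's items stood behind `s` in place of the heavier `t`, and behind
      -- no additional items.
      refine quota_le_quota hI hQ hQ' fun i hi hio => ?_
      have hit : i ≠ t := fun h' => hto.1 (h' ▸ hio)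
      have h1 : I.value t + I.value i ≤ I.capacity := ht.add_le_of_mem hi hit
      refine ⟨hmem.2 ⟨hQ' hi, Or.inr (by linarith)⟩, ?_⟩
      refine total_le_total_of_exchange (ht.mem_above hi hit) hlt.le (I.value_pos s hsE).le
        (fun j hj hjs => ?_) (value_nonneg ((above_subset _ _ _).trans hQ'))
      obtain ⟨hj, hij⟩ := mem_above.1 hj
      obtain ⟨hjt, hj⟩ := Finset.mem_erase.1 (hsub hsk j hj hjs fun h' => hkR (h' ▸ hj))
      exact Finset.mem_erase.2 ⟨hjt, mem_above.2 ⟨hj, hij⟩⟩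

end Erase

end KnapsackInstance

namespace KnapsackInstance

variable {ι : Type*} {I : KnapsackInstance ι}

/-! ### FitTwo depends only on the reported data -/

section Congr

theorem opt_congr {J : KnapsackInstance ι} (hC : I.capacity = J.capacity) {D : Finset ι}
    (hv : ∀ i ∈ D, I.value i = J.value i) (hs : ∀ i ∈ D, I.size i = J.size i) :
    I.opt D = J.opt D := by
  refine argmax_congr (Finset.filter_congr fun D' hD' => ?_) fun D' hD' => ?_
  · rw [hC, total_congr fun i hi => hs i (Finset.mem_powerset.1 hD' hi)]
  · exact total_congr fun i hi =>
      hv i (Finset.mem_powerset.1 (Finset.mem_of_mem_filter D' hD') hi)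

theorem greedyFrac_congr {J : KnapsackInstance ι} (hC : I.capacity = J.capacity) {Q : Finset ι}
    (hv : ∀ i ∈ Q, I.value i = J.value i) (hs : ∀ i ∈ Q, I.size i = J.size i) {i : ι}
    (hi : i ∈ Q) : I.greedyFrac Q i = J.greedyFrac Q i := by
  have hd : ∀ j ∈ Q, I.density j = J.density j := fun j hj => by
    rw [density, density, hv j hj, hs j hj]
  have hb : I.greedyBefore Q i = J.greedyBefore Q i :=
    Finset.filter_congr fun j hj => by rw [hd i hi, hd j hj, hv i hi, hv j hj]
  have ht : total I.size (I.greedyBefore Q i) = total J.size (J.greedyBefore Q i) := by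
    rw [hb]
    exact total_congr fun j hj => hs j (Finset.mem_of_mem_filter j hj)
  rw [greedyFrac, greedyFrac, ht, hC, hs i hi]

/-- Once the number of agents, items and capacity are identified, the instances differ only in data
off the reported items, which no ingredient of FitTwo consults. -/
theorem fitTwo_eq_of_sameData [DecidableEq ι] (β : ℝ) {I J : KnapsackInstance ι}
    (h : I.SameData J) : I.fitTwo β = J.fitTwo β := by
  obtain ⟨n, E, o, v, s, C, p1, p2, p3, p4, p5, p6, p7, p8⟩ := I
  obtain ⟨n', E', o', v', s', C', q1, q2, q3, q4, q5, q6, q7, q8⟩ := J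
  obtain ⟨hn, hE, hC, hd⟩ := h
  dsimp only at hn hE hC hd
  subst hn hE hC
  have ho : ∀ i ∈ E, o i = o' i := fun i hi => Fin.ext (hd i hi).1
  have hv : ∀ i ∈ E, v i = v' i := fun i hi => (hd i hi).2.1
  have hs : ∀ i ∈ E, s i = s' i := fun i hi => (hd i hi).2.2
  let I : KnapsackInstance ι := ⟨n, E, o, v, s, C, p1, p2, p3, p4, p5, p6, p7, p8⟩
  let J : KnapsackInstance ι := ⟨n, E, o', v', s', C, q1, q2, q3, q4, q5, q6, q7, q8⟩
  have hof : ∀ (a : Fin n) (D : Finset ι), D ⊆ E → I.ofAgent a D = J.ofAgent a D :=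
    fun a D hD => Finset.filter_congr fun i hi => by
      rw [show I.owner i = J.owner i from ho i (hD hi)]
  have hopt : ∀ a : Fin n, I.opt (I.ofAgent a E) = J.opt (J.ofAgent a E) := fun a => by
    rw [← hof a E subset_rfl]
    exact opt_congr (I := I) (J := J) rfl (fun i hi => hv i (ofAgent_subset (I := I) a E hi))
      (fun i hi => hs i (ofAgent_subset (I := I) a E hi))
  have hw : ∀ a : Fin n, total v (I.opt (I.ofAgent a E)) = total v' (J.opt (J.ofAgent a E)) :=
    fun a => by
      rw [← hopt a]
      exact total_congr fun i hi =>
        hv i (ofAgent_subset (I := I) a E ((opt_spec I (I.ofAgent a E)).1 hi))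
  have hfit : I.fitSet = J.fitSet := by
    refine Finset.filter_congr fun i hi => forall₂_congr fun j hj => ?_
    rw [show I.owner i = J.owner i from ho i hi, show I.owner j = J.owner j from ho j hj,
      show I.value i = J.value i from hv i hi, show I.value j = J.value j from hv j hj]
  have hfitE : ∀ i ∈ J.fitSet, i ∈ E := fun i hi => (mem_fitSet.1 hi).1
  have hstar : ∀ i, I.IsStar i ↔ J.IsStar i := by
    intro i
    rw [IsStar, IsStar, hfit]
    refine and_congr_right fun hi => forall₂_congr fun j hj => ?_
    rw [show I.value i = J.value i from hv i (hfitE i hi),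
      show I.value j = J.value j from hv j (hfitE j hj)]
  have hR : I.restrictedSet = J.restrictedSet := by
    ext i
    simp only [restrictedSet, Finset.mem_filter]
    refine and_congr_right fun hi => or_congr (hstar i) (exists_congr fun k => ?_)
    rw [hstar k]
    refine and_congr_right fun hk => ?_
    rw [show I.value i = J.value i from hv i hi,
      show I.value k = J.value k from hv k (hfitE k hk.1)]
  have hquota : ∀ a : Fin n, I.quota I.restrictedSet a = J.quota J.restrictedSet a := by
    intro a
    have hRE := restrictedSet_subset I
    rw [← hR, quota, quota, hof a _ hRE]
    refine Finset.sum_congr rfl fun i hi => ?_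
    have hi' := ofAgent_subset (I := J) a _ hi
    rw [show I.value i = J.value i from hv i (hRE hi'),
      greedyFrac_congr (I := I) (J := J) rfl (fun i hi => hv i (hRE hi))
        (fun i hi => hs i (hRE hi)) hi']
  have hgreedy : I.restrictedGreedy I.restrictedSet = J.restrictedGreedy J.restrictedSet := by
    refine Finset.biUnion_congr rfl fun a _ => argmax_congr ?_ fun D hD => ?_
    · refine (Finset.filter_congr fun D hD => ?_).trans
        (congrArg (Finset.filter _) (congrArg Finset.powerset (hof a E subset_rfl)))
      rw [hquota a]
      have : total I.value D = total J.value D :=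
        total_congr fun i hi => hv i (ofAgent_subset (I := I) a E (Finset.mem_powerset.1 hD hi))
      rw [this]
    · exact total_congr fun i hi => hv i (ofAgent_subset (I := I) a E
        (Finset.mem_powerset.1 (Finset.mem_of_mem_filter D hD) hi))
  have : Nonempty (Fin n) := ⟨⟨0, p1⟩⟩
  have hwin : (argmax Finset.univ fun a : Fin n => total v (I.opt (I.ofAgent a E))) =
      argmax Finset.univ fun a : Fin n => total v' (J.opt (J.ofAgent a E)) :=
    argmax_congr rfl fun a _ => hw a
  have hcond : (∃ a : Fin n, β * C ≤ total v (I.opt (I.ofAgent a E))) ↔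
      ∃ a : Fin n, β * C ≤ total v' (J.opt (J.ofAgent a E)) :=
    exists_congr fun a => by rw [hw a]
  change I.fitTwo β = J.fitTwo β
  by_cases hbig : ∃ a : Fin n, β * C ≤ total v (I.opt (I.ofAgent a E))
  · refine (if_pos hbig).trans (Eq.trans ?_ (if_pos (hcond.1 hbig)).symm)
    exact (hopt _).trans (congrArg (fun a : Fin n => J.opt (J.ofAgent a E)) hwin)
  · exact (if_neg hbig).trans (hgreedy.trans (if_neg fun h => hbig (hcond.2 h)).symm)

end Congr

/-! ### The two regimes of FitTwo and feasibility -/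

section FitTwo

/-- An agent with the most valuable optimal packing of the own items. -/
noncomputable def winner (I : KnapsackInstance ι) : Fin I.n :=
  argmax Finset.univ fun a : Fin I.n => total I.value (I.opt (I.ofAgent a I.items))

theorem le_winner (I : KnapsackInstance ι) (a : Fin I.n) :
    total I.value (I.opt (I.ofAgent a I.items)) ≤
      total I.value (I.opt (I.ofAgent I.winner I.items)) :=
  (argmax_spec Finset.univ (fun a : Fin I.n => total I.value (I.opt (I.ofAgent a I.items)))
    ⟨a, Finset.mem_univ a⟩).2 a (Finset.mem_univ a)

variable [DecidableEq ι]

theorem fitTwo_of_le {β : ℝ} {a : Fin I.n}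
    (h : β * I.capacity ≤ total I.value (I.opt (I.ofAgent a I.items))) :
    I.fitTwo β = I.opt (I.ofAgent I.winner I.items) :=
  if_pos ⟨a, h⟩

theorem fitTwo_of_lt {β : ℝ}
    (h : ∀ a, total I.value (I.opt (I.ofAgent a I.items)) < β * I.capacity) :
    I.fitTwo β = I.restrictedGreedy I.restrictedSet :=
  if_neg fun ⟨a, ha⟩ => (h a).not_ge ha

theorem fitTwo_subset (β : ℝ) (hI : I ∈ unitDensity ι) : I.fitTwo β ⊆ I.items := by
  by_cases h : ∃ a, β * I.capacity ≤ total I.value (I.opt (I.ofAgent a I.items))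
  · obtain ⟨a, ha⟩ := h
    rw [fitTwo_of_le ha]
    exact (I.opt_spec _).1.trans (ofAgent_subset _ _)
  · push Not at h
    rw [fitTwo_of_lt h]
    exact restrictedGreedy_subset hI (restrictedSet_subset I)

theorem fitTwo_feasible (β : ℝ) (hI : I ∈ unitDensity ι) :
    total I.size (I.fitTwo β) ≤ I.capacity := by
  by_cases h : ∃ a, β * I.capacity ≤ total I.value (I.opt (I.ofAgent a I.items))
  · obtain ⟨a, ha⟩ := h
    rw [fitTwo_of_le ha]
    exact (I.opt_spec _).2.1
  · rw [total_size_eq hI (fitTwo_subset β hI)]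
    push Not at h
    rw [fitTwo_of_lt h]
    exact total_restrictedGreedy_le hI (restrictedSet_subset I)

theorem agentValue_fitTwo_le (β : ℝ) (hI : I ∈ unitDensity ι) (a : Fin I.n) :
    I.agentValue a (I.fitTwo β) ≤ total I.value (I.opt (I.ofAgent a I.items)) := by
  have hsub := fitTwo_subset β hI
  refine le_total_opt hI (ofAgent_subset _ _) (ofAgent_subset_ofAgent a hsub) ?_
  refine (total_le_total (ofAgent_subset _ _) (value_nonneg hsub)).trans ?_
  rw [← total_size_eq hI hsub]
  exact fitTwo_feasible β hI

end FitTwo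

/-! ### Strategyproofness -/

section Strategyproof

variable [DecidableEq ι]

/-- Items are hidden one at a time; since `opt` is monotone, every intermediate instance still
satisfies the smallness hypothesis. -/
theorem quota_restrictedSet_sdiff_le {β : ℝ} (hI : I ∈ unitDensity ι) (hβ : β ≤ 2 / 3)
    (hsmall : ∀ a, total I.value (I.opt (I.ofAgent a I.items)) < β * I.capacity) (a : Fin I.n)
    (T : Finset ι) : T ⊆ I.ofAgent a I.items → ∀ (E' : Finset ι) (h : E' ⊆ I.items),
      E' = I.items \ T →
        I.quota (I.restrict E' h).restrictedSet a ≤ I.quota I.restrictedSet a := by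
  induction T using Finset.induction_on with
  | empty =>
    intro _ E' h hE'
    obtain rfl : E' = I.items := by simpa using hE'
    exact le_rfl
  | insert k T hkT ih =>
    intro hT E' h hE'
    obtain ⟨hk, rfl⟩ := mem_ofAgent.1 (hT (Finset.mem_insert_self k T))
    have h1 := ih ((Finset.subset_insert k T).trans hT) _ Finset.sdiff_subset rfl
    have hE'' : E' = (I.items \ T).erase k := by
      rw [hE', Finset.sdiff_insert]
    have hsub : I.items \ T ⊆ I.items := Finset.sdiff_subset
    exact (quota_restrictedSet_erase_le (I := I.restrict (I.items \ T) hsub)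
      (restrict_mem_unitDensity hI hsub) hβ
      (fun b => (I.opt_mono (ofAgent_subset_ofAgent b hsub)).trans_lt (hsmall b))
      (Finset.mem_sdiff.2 ⟨hk, hkT⟩) (hE'' ▸ Finset.erase_subset _ _) hE'').trans h1

theorem agentValue_fitTwo_restrict_le {β : ℝ} (hI : I ∈ unitDensity ι) (hβ₀ : 0 < β)
    (hβ : β ≤ 2 / 3) (a : Fin I.n) (E' : Finset ι) (h : E' ⊆ I.items)
    (hdiff : I.items \ E' ⊆ I.ofAgent a I.items) :
    I.agentValue a ((I.restrict E' h).fitTwo β) ≤ I.agentValue a (I.fitTwo β) := by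
  have hJI := restrict_mem_unitDensity hI h
  by_cases hbig : ∃ b, β * I.capacity ≤ total I.value (I.opt (I.ofAgent b I.items))
  · obtain ⟨b, hb⟩ := hbig
    have hwin := hb.trans (I.le_winner b)
    by_cases ha : I.winner = a
    · have h1 : I.agentValue a ((I.restrict E' h).fitTwo β) ≤
          total I.value (I.opt (I.ofAgent a E')) :=
        agentValue_fitTwo_le β hJI a
      have h2 : I.agentValue a (I.fitTwo β) = total I.value (I.opt (I.ofAgent a I.items)) := by
        rw [fitTwo_of_le hb, ha, agentValue, ofAgent_eq_self (I.opt_spec _).1]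
      rw [h2]
      exact h1.trans (I.opt_mono (ofAgent_subset_ofAgent a h))
    · have h1 : I.ofAgent I.winner I.items = I.ofAgent I.winner E' := by
        refine subset_antisymm (fun i hi => ?_) (ofAgent_subset_ofAgent _ h)
        obtain ⟨hi, ho⟩ := mem_ofAgent.1 hi
        refine mem_ofAgent.2 ⟨?_, ho⟩
        by_contra hiE'
        exact ha (ho.symm.trans (mem_ofAgent.1 (hdiff (Finset.mem_sdiff.2 ⟨hi, hiE'⟩))).2)
      have h2 : (I.restrict E' h).fitTwo β = I.opt (I.ofAgent (I.restrict E' h).winner E') :=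
        fitTwo_of_le (I := I.restrict E' h) (a := I.winner) (h1 ▸ hwin)
      -- If the hider won, monotonicity would force a tie with the true winner. Equal values mean
      -- equal packings, and a packing owned by two agents is empty, contradicting value at least
      -- `βC > 0`.
      have h3 : (I.restrict E' h).winner ≠ a := by
        intro hw
        have h4 : total I.value (I.opt (I.ofAgent I.winner E')) ≤
            total I.value (I.opt (I.ofAgent (I.restrict E' h).winner E')) :=
          (I.restrict E' h).le_winner I.winner
        rw [hw, ← h1] at h4
        have h5 := I.opt_mono (ofAgent_subset_ofAgent a h)
        have h6 := eq_of_total_value_eq hI ((I.opt_spec _).1.trans (ofAgent_subset _ _))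
          ((I.opt_spec _).1.trans (ofAgent_subset _ _)) (total_opt_le hI (ofAgent_subset _ _))
          (le_antisymm (I.le_winner a) (h4.trans h5))
        have h7 : I.opt (I.ofAgent a I.items) = ∅ := by
          refine Finset.eq_empty_of_forall_notMem fun i hi => ha ?_
          rw [← (mem_ofAgent.1 ((I.opt_spec _).1 hi)).2]
          exact (mem_ofAgent.1 ((I.opt_spec _).1 (h6 ▸ hi))).2.symm
        rw [← h6, h7] at hwin
        exact (mul_pos hβ₀ I.capacity_pos).not_ge (by simpa [total] using hwin)
      have h8 : I.ofAgent a ((I.restrict E' h).fitTwo β) = ∅ := by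
        rw [h2]
        refine Finset.filter_eq_empty_iff.2 fun i hi ho => h3 ?_
        rw [← (mem_ofAgent.1 ((I.opt_spec _).1 hi)).2]
        exact ho
      rw [agentValue, h8, total, Finset.sum_empty]
      exact total_nonneg (value_nonneg ((ofAgent_subset _ _).trans (fitTwo_subset β hI)))
  · push Not at hbig
    have hq := quota_restrictedSet_sdiff_le hI hβ hbig a _ hdiff E' h
      (Finset.sdiff_sdiff_eq_self h).symm
    have hRJ : (I.restrict E' h).restrictedSet ⊆ (I.restrict E' h).items :=
      restrictedSet_subset _
    obtain ⟨h1, h2, -⟩ := share_spec hJI hRJ a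
    rw [fitTwo_of_lt hbig, fitTwo_of_lt (I := I.restrict E' h)
      fun b => (I.opt_mono (ofAgent_subset_ofAgent b h)).trans_lt (hbig b), agentValue, agentValue,
      ofAgent_restrictedGreedy hI (restrictedSet_subset I)]
    rw [show I.ofAgent a ((I.restrict E' h).restrictedGreedy (I.restrict E' h).restrictedSet) =
      (I.restrict E' h).share (I.restrict E' h).restrictedSet a from
        ofAgent_restrictedGreedy hJI hRJ a]
    -- The share after hiding respects the larger quota without hiding, so it competes there.
    exact (share_spec hI (restrictedSet_subset I) a).2.2 _
      (h1.trans (ofAgent_subset_ofAgent a h)) (h2.trans hq)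

end Strategyproof

/-! ### The approximation ratio -/

section Approximation

/-- If some item lies outside the restricted set, then `i*` is not small. -/
theorem le_value_star {β : ℝ} (hI : I ∈ unitDensity ι)
    (hsmall : ∀ a, total I.value (I.opt (I.ofAgent a I.items)) < β * I.capacity) {s j : ι}
    (hs : I.IsStar s) (hj : j ∈ I.items) (hjR : j ∉ I.restrictedSet) :
    (1 - β) * I.capacity ≤ I.value s := by
  have hC : I.capacity < I.value s + I.value j := by
    by_contra! hc
    exact hjR (hs.mem_restrictedSet_iff.2 ⟨hj, Or.inr hc⟩)
  have h1 := value_lt_of_small hI hsmall hj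
  linarith

variable [DecidableEq ι]

/-- If not all of the restricted set can be packed, then at least two thirds of the capacity are
filled. -/
theorem two_thirds_le_total_restrictedGreedy (hI : I ∈ unitDensity ι)
    (hR : I.capacity < total I.value I.restrictedSet) :
    2 / 3 * I.capacity ≤ total I.value (I.restrictedGreedy I.restrictedSet) := by
  have hQ := restrictedSet_subset I
  set R := I.restrictedSet with hRdef
  have hne : R.Nonempty := by
    by_contra hemp
    rw [Finset.not_nonempty_iff_eq_empty.1 hemp, total, Finset.sum_empty] at hR
    exact hR.not_gt I.capacity_pos
  obtain ⟨s, hs⟩ := exists_isStar (hne.mono hQ)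
  obtain ⟨m, hm, hmin⟩ := R.exists_min_image I.value hne
  have hmcut : I.capacity < total I.value (above I.value R m) + I.value m := by
    refine hR.trans_le ?_
    have h1 : R ⊆ insert m (above I.value R m) := by
      intro j hj
      by_cases hjm : j = m
      · exact hjm ▸ Finset.mem_insert_self _ _
      · exact Finset.mem_insert_of_mem (mem_above.2 ⟨hj, lt_of_le_of_ne (hmin j hj)
          fun h => hjm (eq_of_value_eq (hQ hj) (hQ hm) h.symm)⟩)
    have h2 : m ∉ above I.value R m := fun h => lt_irrefl _ (mem_above.1 h).2
    have h3 : total I.value (insert m (above I.value R m)) =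
        I.value m + total I.value (above I.value R m) := Finset.sum_insert h2
    rw [add_comm, ← h3]
    exact total_le_total h1 (value_nonneg
      (Finset.insert_subset (hQ hm) ((above_subset _ _ _).trans hQ)))
  -- Here `r` is the first item in greedy order that is not packed whole; everything above it is.
  obtain ⟨r, hr, hmax⟩ := (R.filter fun i =>
    I.capacity < total I.value (above I.value R i) + I.value i).exists_max_image I.value
    ⟨m, Finset.mem_filter.2 ⟨hm, hmcut⟩⟩
  obtain ⟨hrR, hrcut⟩ := Finset.mem_filter.1 hr
  have hfull := le_total_restrictedGreedy hI hQ (above_subset I.value R r) fun i hi => by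
    by_contra! hcut
    exact (mem_above.1 hi).2.not_ge (hmax i (Finset.mem_filter.2 ⟨(mem_above.1 hi).1, hcut⟩))
  have hrs : r ≠ s := fun h => (hs.fits hI).not_gt (h ▸ hrcut)
  have hsr := hs.mem_above hrR hrs
  -- If `s` alone preceded `r`, then `r` would fit. So two items larger than `r` are packed, and
  -- with `r` the packed part exceeds `C`, hence that part exceeds `2C/3`.
  obtain ⟨j, hj, hjs⟩ : ∃ j ∈ above I.value R r, j ≠ s := by
    by_contra! hall
    have h1 : above I.value R r = {s} := Finset.eq_singleton_iff_unique_mem.2 ⟨hsr, hall⟩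
    rw [h1, total, Finset.sum_singleton] at hrcut
    exact hrcut.not_ge (hs.add_le_of_mem hrR hrs)
  have hpair : total I.value {j, s} ≤ total I.value (above I.value R r) :=
    total_le_total (Finset.insert_subset hj (Finset.singleton_subset_iff.2 hsr))
      (value_nonneg ((above_subset _ _ _).trans hQ))
  have hpair' : total I.value {j, s} = I.value j + I.value s := Finset.sum_pair hjs
  have h1 := (mem_above.1 hj).2
  have h2 := (mem_above.1 hsr).2
  linarith

/-- The optimum exceeds the value of `R \ {i*}` by at most the worth of a packing of a single
agent, unless it is contained in `R`. -/
theorem total_opt_add_star_le {β : ℝ} (hI : I ∈ unitDensity ι)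
    (hsmall : ∀ a, total I.value (I.opt (I.ofAgent a I.items)) < β * I.capacity) {s : ι}
    (hs : I.IsStar s) (hopt : ¬ I.opt I.items ⊆ I.restrictedSet) :
    total I.value (I.opt I.items) + I.value s ≤
      β * I.capacity + total I.value I.restrictedSet := by
  have hQ := restrictedSet_subset I
  obtain ⟨hOE, hOC, -⟩ := I.opt_spec I.items
  rw [total_size_eq hI hOE] at hOC
  set O := I.opt I.items with hO
  set R := I.restrictedSet with hR
  have hnotR : ∀ j ∈ O, j ∉ R → I.capacity < I.value s + I.value j := fun j hj hjR => by
    by_contra! hc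
    exact hjR (hs.mem_restrictedSet_iff.2 ⟨hOE hj, Or.inr hc⟩)
  have hpairO : ∀ i ∈ O, ∀ j ∈ O, i ≠ j → I.value i + I.value j ≤ I.capacity := by
    intro i hi j hj hij
    have h1 : total I.value {i, j} = I.value i + I.value j := Finset.sum_pair hij
    rw [← h1]
    exact (total_le_total (Finset.insert_subset hi (Finset.singleton_subset_iff.2 hj))
      (value_nonneg hOE)).trans hOC
  obtain ⟨j, hjO, hjR⟩ := Finset.not_subset.1 hopt
  have hsO : s ∉ O := fun hsO => by
    have h1 := hpairO s hsO j hjO fun h => hjR (h ▸ hs.mem_restrictedSet)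
    exact (hnotR j hjO hjR).not_ge h1
  have hsplit : total I.value (O.filter fun i => i ∈ R) +
      total I.value (O.filter fun i => i ∉ R) = total I.value O :=
    Finset.sum_filter_add_sum_filter_not _ _ _
  have hin : total I.value (O.filter fun i => i ∈ R) + I.value s ≤ total I.value R := by
    have h1 : total I.value (R.erase s) + I.value s = total I.value R :=
      Finset.sum_erase_add R I.value hs.mem_restrictedSet
    have h2 : total I.value (O.filter fun i => i ∈ R) ≤ total I.value (R.erase s) :=
      total_le_total (fun i hi => Finset.mem_erase.2
        ⟨fun h => hsO (h ▸ (Finset.mem_filter.1 hi).1), (Finset.mem_filter.1 hi).2⟩)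
        (value_nonneg ((Finset.erase_subset _ _).trans hQ))
    linarith
  have hout : total I.value (O.filter fun i => i ∉ R) ≤ β * I.capacity := by
    have hsub : (O.filter fun i => i ∉ R) ⊆ O := Finset.filter_subset _ _
    -- An outside item above `s` is alone, since any other outside item overflows already with `s`.
    -- If none is above `s`, membership of `s` in `P` makes them all belong to the owner of `s`.
    obtain ⟨b, hb⟩ : ∃ b, (O.filter fun i => i ∉ R) ⊆ I.ofAgent b I.items := by
      by_cases hbig : ∃ k ∈ O.filter fun i => i ∉ R, I.value s < I.value k
      · obtain ⟨k, hk, hsk⟩ := hbig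
        refine ⟨I.owner k, fun i hi => mem_ofAgent.2 ⟨hOE (hsub hi), ?_⟩⟩
        obtain rfl : i = k := by
          by_contra hik
          have h1 := hpairO i (hsub hi) k (hsub hk) hik
          have h2 := hnotR i (hsub hi) (Finset.mem_filter.1 hi).2
          linarith
        rfl
      · push Not at hbig
        refine ⟨I.owner s, fun i hi => mem_ofAgent.2 ⟨hOE (hsub hi), ?_⟩⟩
        have h1 := hnotR i (hsub hi) (Finset.mem_filter.1 hi).2
        by_contra ho
        refine h1.not_ge ((mem_fitSet.1 hs.1).2 i (hOE (hsub hi)) ho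
          (lt_of_le_of_ne (hbig i hi) fun h => hsO ?_))
        exact eq_of_value_eq (hOE (hsub hi)) hs.mem h ▸ hsub hi
    refine (le_total_opt hI (ofAgent_subset b _) hb
      ((total_le_total hsub (value_nonneg hOE)).trans hOC)).trans (hsmall b).le
  linarith

theorem le_total_fitTwo {β : ℝ} (hI : I ∈ unitDensity ι) (hβ₁ : 1 / 2 ≤ β) (hβ₂ : β ≤ 2 / 3) :
    min β ((1 - β) / β) * total I.value (I.opt I.items) ≤ total I.value (I.fitTwo β) := by
  have hβ₀ : 0 < β := by linarith
  have hO₀ : 0 ≤ total I.value (I.opt I.items) :=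
    total_nonneg (value_nonneg (I.opt_spec I.items).1)
  have hOC := total_opt_le hI (subset_refl I.items)
  have hmin := mul_le_mul_of_nonneg_right (min_le_left β ((1 - β) / β)) hO₀
  have hβO := mul_le_mul_of_nonneg_left hOC hβ₀.le
  have hQ := restrictedSet_subset I
  by_cases hbig : ∃ b, β * I.capacity ≤ total I.value (I.opt (I.ofAgent b I.items))
  · obtain ⟨b, hb⟩ := hbig
    rw [fitTwo_of_le hb]
    linarith [I.le_winner b]
  push Not at hbig
  rw [fitTwo_of_lt hbig]
  rcases lt_or_ge I.capacity (total I.value I.restrictedSet) with hR | hR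
  · have h1 := two_thirds_le_total_restrictedGreedy hI hR
    have h2 := mul_le_mul_of_nonneg_right hβ₂ I.capacity_pos.le
    linarith
  have hall : total I.value I.restrictedSet ≤
      total I.value (I.restrictedGreedy I.restrictedSet) := by
    refine le_total_restrictedGreedy hI hQ subset_rfl fun i hi => le_trans ?_ hR
    have h1 : i ∉ above I.value I.restrictedSet i := fun h => lt_irrefl _ (mem_above.1 h).2
    have h2 : total I.value (insert i (above I.value I.restrictedSet i)) =
        I.value i + total I.value (above I.value I.restrictedSet i) := Finset.sum_insert h1
    rw [add_comm, ← h2]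
    exact total_le_total (Finset.insert_subset hi (above_subset _ _ _)) (value_nonneg hQ)
  by_cases hopt : I.opt I.items ⊆ I.restrictedSet
  · have h1 := total_le_total hopt (value_nonneg hQ)
    have h2 : β * total I.value (I.opt I.items) ≤ 1 * total I.value (I.opt I.items) :=
      mul_le_mul_of_nonneg_right (by linarith) hO₀
    linarith
  · obtain ⟨j, hjO, hjR⟩ := Finset.not_subset.1 hopt
    have hjE := (I.opt_spec I.items).1 hjO
    obtain ⟨s, hs⟩ := exists_isStar ⟨j, hjE⟩
    have h1 := total_opt_add_star_le hI hbig hs hopt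
    have h2 := le_value_star hI hbig hs hjE hjR
    have h3 := weight_le_total hs.mem_restrictedSet (value_nonneg hQ)
    refine le_trans ((mul_le_mul_of_nonneg_right (min_le_right _ _) hO₀).trans ?_) hall
    rw [div_mul_eq_mul_div, div_le_iff₀ hβ₀]
    -- After inserting `h1`, it remains that `(1 - β)βC ≤ (2β - 1) v(R) + (1 - β) v_s`. As `β ≥ 1/2`
    -- and `v(R) ≥ v_s`, the right side is at least `β v_s ≥ β(1 - β)C`.
    nlinarith [mul_le_mul_of_nonneg_left h1 (show 0 ≤ 1 - β by linarith),
      mul_le_mul_of_nonneg_left h2 hβ₀.le,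
      mul_nonneg (show 0 ≤ 2 * β - 1 by linarith) (sub_nonneg.2 h3)]

end Approximation

end KnapsackInstance

/-! ### The mechanism and the golden ratio -/

section Main

open KnapsackInstance

variable {ι : Type*}

theorem KnapsackInstance.SameData.mem_unitDensity {I J : KnapsackInstance ι}
    (h : I.SameData J) (hI : I ∈ unitDensity ι) : J ∈ unitDensity ι := by
  intro i hi
  rw [← h.2.1] at hi
  obtain ⟨-, hv, hs⟩ := h.2.2.2 i hi
  rw [density, ← hv, ← hs]
  exact hI i hi

theorem KnapsackInstance.SameData.symm {I J : KnapsackInstance ι} (h : I.SameData J) :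
    J.SameData I := by
  obtain ⟨h1, h2, h3, h4⟩ := h
  exact ⟨h1.symm, h2.symm, h3.symm, fun i hi =>
    ⟨(h4 i (h2 ▸ hi)).1.symm, (h4 i (h2 ▸ hi)).2.1.symm, (h4 i (h2 ▸ hi)).2.2.symm⟩⟩

open Classical in
/-- FitTwo as a mechanism. Instances without unit density, on which FitTwo need not be feasible,
are left unpacked. -/
noncomputable def fitTwoMechanism (ι : Type*) [DecidableEq ι] (β : ℝ) : DetMechanism ι where
  pack I := if I ∈ unitDensity ι then I.fitTwo β else ∅
  pack_subset I := by
    split_ifs with hI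
    · exact fitTwo_subset β hI
    · exact Finset.empty_subset _
  pack_feasible I := by
    split_ifs with hI
    · exact fitTwo_feasible β hI
    · simpa [total] using I.capacity_pos.le
  pack_congr I J h := by
    by_cases hI : I ∈ unitDensity ι
    · rw [if_pos hI, if_pos (h.mem_unitDensity hI), fitTwo_eq_of_sameData β h]
    · rw [if_neg hI, if_neg fun hJ => hI (h.symm.mem_unitDensity hJ)]

variable [DecidableEq ι]

theorem fitTwoMechanism_pack (β : ℝ) {I : KnapsackInstance ι} (hI : I ∈ unitDensity ι) :
    (fitTwoMechanism ι β).pack I = I.fitTwo β :=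
  if_pos hI

theorem fitTwoMechanism_strategyproofOn {β : ℝ} (hβ₁ : 1 / 2 ≤ β) (hβ₂ : β ≤ 2 / 3) :
    (fitTwoMechanism ι β).StrategyproofOn (unitDensity ι) := by
  intro I hI a E' h hdiff
  rw [fitTwoMechanism_pack β hI, fitTwoMechanism_pack β (restrict_mem_unitDensity hI h)]
  exact agentValue_fitTwo_restrict_le hI (by linarith) hβ₂ a E' h hdiff

theorem fitTwoMechanism_approximateOn {β : ℝ} (hβ₁ : 1 / 2 ≤ β) (hβ₂ : β ≤ 2 / 3) :
    (fitTwoMechanism ι β).ApproximateOn (min β ((1 - β) / β)) (unitDensity ι) := by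
  intro I hI
  rw [fitTwoMechanism_pack β hI]
  exact le_total_fitTwo hI hβ₁ hβ₂

end Main

theorem mainTheorem4 {ι : Type*} [DecidableEq ι] :
    (∀ β : ℝ, 1 / 2 ≤ β → β ≤ 2 / 3 →
      ∃ M : DetMechanism ι,
        (∀ I ∈ KnapsackInstance.unitDensity ι, M.pack I = KnapsackInstance.fitTwo β I) ∧
        M.StrategyproofOn (KnapsackInstance.unitDensity ι) ∧
        M.ApproximateOn (min β ((1 - β) / β)) (KnapsackInstance.unitDensity ι)) ∧
    (∃ M : DetMechanism ι,
      (∀ I ∈ KnapsackInstance.unitDensity ι,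
        M.pack I = KnapsackInstance.fitTwo (1 / Real.goldenRatio) I) ∧
      M.StrategyproofOn (KnapsackInstance.unitDensity ι) ∧
      M.ApproximateOn (1 / Real.goldenRatio) (KnapsackInstance.unitDensity ι)) := by
  have hφ₀ := Real.goldenRatio_pos
  have hφ := Real.goldenRatio_sq
  have h1 : 1 / 2 ≤ 1 / Real.goldenRatio :=
    one_div_le_one_div_of_le hφ₀ Real.goldenRatio_lt_two.le
  have h2 : 1 / Real.goldenRatio ≤ 2 / 3 := by
    rw [div_le_div_iff₀ hφ₀ (by norm_num)]
    nlinarith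
  -- The two terms of the minimum meet where `β² = 1 - β`, that is, at `β = 1/φ`.
  have h3 : (1 - 1 / Real.goldenRatio) / (1 / Real.goldenRatio) = 1 / Real.goldenRatio := by
    generalize Real.goldenRatio = φ at hφ₀ hφ
    field_simp
    linarith
  have happrox := fitTwoMechanism_approximateOn (ι := ι) h1 h2
  rw [h3, min_self] at happrox
  exact ⟨fun β hβ₁ hβ₂ => ⟨fitTwoMechanism ι β, fun I hI => fitTwoMechanism_pack β hI,
      fitTwoMechanism_strategyproofOn hβ₁ hβ₂, fitTwoMechanism_approximateOn hβ₁ hβ₂⟩,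
    fitTwoMechanism ι (1 / Real.goldenRatio), fun I hI => fitTwoMechanism_pack _ hI,
    fitTwoMechanism_strategyproofOn h1 h2, happrox⟩
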